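/- Let $\mathcal H$ be a complex Hilbert space with inner product antilinear in its first argument. For a linear operator $A$ in $\mathcal H$ with domain $\operatorname{dom}(A)\subseteq\mathcal H$ (a linear subspace, not necessarily dense), let $$A^*=\{(\eta,\omega)\in\mathcal H\oplus\mathcal H:\langle\eta,A\varphi\rangle=\langle\omega,\varphi\rangle\text{ for all }\varphi\in\operatorname{dom}(A)\}$$ be its adjoint linear relation, and for $z\in\mathbb C$ put $\ker(A^*-zI)=\{\eta\in\mathcal H:(\eta,z\eta)\in A^*\}$. Let $\mathscr S(\mathcal H)$ be the class of linear operators $A$ in $\mathcal H$ that are closed, symmetric ($\langle A\varphi,\psi\rangle=\langle\varphi,A\psi\rangle$ for all $\varphi,\psi\in\operatorname{dom}(A)$), have deficiency indices $(1,1)$ ($\dim\ker(A^*-iI)=\dim\ker(A^*+iI)=1$), and are regular (for every $z\in\mathbb C$ there is $d_z>0$ with $\|(A-zI)\psi\|\ge d_z\|\psi\|$ for all $\psi\in\operatorname{dom}(A)$). For an integer $n\ge 0$, an operator $A$ is called $n$-entire if $A\in\mathscr S(\mathcal H)$ and there are vectors $\mu_0,\dots,\mu_n\in\mathcal H$ such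 that $$\mathcal H=\operatorname{ran}(A-zI)\dotplus\operatorname{span}\{\mu_0+z\mu_1+\cdots+z^n\mu_n\}\qquad\text{for all }z\in\mathbb C,$$ where $\dotplus$ denotes the direct sum of linear subspaces. **Proposition.** Let $n\ge 0$ be an integer and $A\in\mathscr S(\mathcal H)$. Suppose that there are vectors $\eta_0,\dots,\eta_n\in\mathcal H$ such that $$\mathcal H=\operatorname{ran}(A-zI)\dotplus\operatorname{span}\{\eta_0+z\eta_1+\cdots+z^n\eta_n\}$$ holds for all $z\in\mathbb C$ except finitely many points. Then $A$ is $n$-entire. -/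

import Mathlib

open scoped InnerProductSpace

namespace NEntire

variable {H : Type*} [NormedAddCommGroup H] [InnerProductSpace ℂ H]

/-- The operator `A - zI`, a linear map on the domain of `A`. -/
def shift (A : H →ₗ.[ℂ] H) (z : ℂ) : A.domain →ₗ[ℂ] H :=
  A.toFun - z • A.domain.subtype

/-- `ran (A - zI)`. -/
def ranShift (A : H →ₗ.[ℂ] H) (z : ℂ) : Submodule ℂ H :=
  LinearMap.range (shift A z)

/-- The adjoint `A*` as a linear relation (the domain of `A` need not be dense):
all pairs `(η, ω)` with `⟪η, A φ⟫ = ⟪ω, φ⟫` for every `φ` in the domain of `A`. -/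
def adjointRel (A : H →ₗ.[ℂ] H) : Submodule ℂ (H × H) where
  carrier := {p | ∀ φ : A.domain, ⟪p.1, A φ⟫_ℂ = ⟪p.2, (φ : H)⟫_ℂ}
  add_mem' := by
    intro p q hp hq φ
    simp only [Prod.fst_add, Prod.snd_add, inner_add_left, hp φ, hq φ]
  zero_mem' := by
    intro φ
    simp
  smul_mem' := by
    intro c p hp φ
    simp only [Prod.smul_fst, Prod.smul_snd, inner_smul_left, hp φ]

/-- `ker (A* - zI)`: all `η` with `(η, 0) ∈ A* - zI`, that is, `(η, zη) ∈ A*`. -/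
def kerAdjoint (A : H →ₗ.[ℂ] H) (z : ℂ) : Submodule ℂ H :=
  (adjointRel A).comap (LinearMap.prod LinearMap.id (z • LinearMap.id))

/-- `A` is symmetric (not necessarily densely defined). -/
def IsSymmetricOp (A : H →ₗ.[ℂ] H) : Prop :=
  ∀ φ ψ : A.domain, ⟪A φ, (ψ : H)⟫_ℂ = ⟪(φ : H), A ψ⟫_ℂ

/-- `A` has deficiency indices `(1,1)`: `dim ker (A* - iI) = dim ker (A* + iI) = 1`. -/
def HasDeficiencyIndicesOneOne (A : H →ₗ.[ℂ] H) : Prop :=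
  Module.rank ℂ (kerAdjoint A Complex.I) = 1 ∧
    Module.rank ℂ (kerAdjoint A (-Complex.I)) = 1

/-- `A` is regular: every complex number is a point of regular type. -/
def IsRegularOp (A : H →ₗ.[ℂ] H) : Prop :=
  ∀ z : ℂ, ∃ d : ℝ, 0 < d ∧ ∀ ψ : A.domain, d * ‖(ψ : H)‖ ≤ ‖shift A z ψ‖

variable (H) in
/-- The class `𝒮(H)` of regular, closed symmetric operators in `H` with
deficiency indices `(1,1)`. -/
def classS : Set (H →ₗ.[ℂ] H) :=
  {A | A.IsClosed ∧ IsSymmetricOp A ∧ HasDeficiencyIndicesOneOne A ∧ IsRegularOp A}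

/-- At the point `z`, the space `H` is the (algebraic) direct sum of `ran (A - zI)` and
`span {μ₀ + z μ₁ + ⋯ + zⁿ μₙ}`. -/
def DecomposesAt (A : H →ₗ.[ℂ] H) {n : ℕ} (μ : Fin (n + 1) → H) (z : ℂ) : Prop :=
  IsCompl (ranShift A z) (Submodule.span ℂ {∑ j : Fin (n + 1), z ^ (j : ℕ) • μ j})

variable (H) in
/-- The class of `n`-entire operators in `H`. -/
def nEntireClass (n : ℕ) : Set (H →ₗ.[ℂ] H) :=
  {A | A ∈ classS H ∧ ∃ μ : Fin (n + 1) → H, ∀ z : ℂ, DecomposesAt A μ z}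

end NEntire

/-!
The idea is to divide the vector polynomial `η(z) = η₀ + z η₁ + ⋯ + zⁿ ηₙ` by its "zeros", that is,
by the points `w` at which `η(w)` lies in `ran (A - wI)`, without raising its degree.

*Geometry of the ranges.* Each `ran (A - wI)` is closed, and with `S` the bounded operator
`(A - wI)⁻¹` composed with the orthogonal projection onto that range one has
`ran (A - zI) = (1 - (z - w) S) (ran (A - wI))` for every `z` (`exists_ranShift_eq_map`). As
`1 - (z - w) S` is invertible for `z` near `w`, being a hyperplane is an open and closed condition
on `z`; it holds at `z = -i` by the assumption on the deficiency indices, hence everywhere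
(`isCoatom_ranShift`). The decomposition at `z` therefore says exactly that `η(z)` is not in
`ran (A - zI)`. The same formula gives functionals `F z`, analytic in `z` near `w`, with
`ker (F z) = ran (A - zI)` (`exists_analyticAt_functional`).

*Division.* If `η(w) = (A - wI) ψ`, write `η(z) = η(w) + (z - w) q(z)` and put `μ(z) = q(z) + ψ`.
Then `η(z) - (z - w) μ(z) = (A - zI) ψ` (`exists_vecPoly_div`). So `μ(z)` is outside
`ran (A - zI)` whenever `z ≠ w` and `η(z)` is, and `F z (η(z)) = (z - w) F z (μ(z))` near `w`: the
vanishing order at `w` drops by one. The order is finite because the exceptional points are isolated;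
so finitely many divisions remove `w` from the exceptional set (`exists_vecPoly_notMem_at`), and
finitely many such removals empty it.
-/

open scoped InnerProductSpace Topology
open Filter

namespace NEntire

variable {H : Type*} [NormedAddCommGroup H] [InnerProductSpace ℂ H]

/-! ### The ranges of `A - zI` -/

theorem shift_apply (A : H →ₗ.[ℂ] H) (z : ℂ) (ψ : A.domain) :
    shift A z ψ = A ψ - z • (ψ : H) := rfl

theorem shift_eq_sub (A : H →ₗ.[ℂ] H) (z w : ℂ) (ψ : A.domain) :
    shift A z ψ = shift A w ψ - (z - w) • (ψ : H) := by
  simp only [shift_apply, sub_smul]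
  abel

/-- The range of `A - wI` is the image of the graph of `A` under `(x, y) ↦ y - w x`, which is bounded
below by regularity; the graph is complete since `A` is closed. -/
theorem isClosed_ranShift [CompleteSpace H] {A : H →ₗ.[ℂ] H} (hcl : A.IsClosed)
    (hreg : IsRegularOp A) (w : ℂ) : IsClosed (ranShift A w : Set H) := by
  obtain ⟨d, hd, hbound⟩ := hreg w
  have : CompleteSpace A.graph := IsClosed.completeSpace_coe (hs := hcl)
  let T : H × H →L[ℂ] H := ContinuousLinearMap.snd ℂ H H - w • ContinuousLinearMap.fst ℂ H H
  let T' : A.graph →L[ℂ] H := T.comp A.graph.subtypeL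
  -- The bound combines `‖x‖ ≤ d⁻¹ ‖y - w x‖` with `‖y‖ ≤ ‖y - w x‖ + ‖w‖ ‖x‖`.
  have hT' : ∀ p : A.graph, ‖p‖ ≤ (1 + (‖w‖ + 1) * d⁻¹) * ‖T' p‖ := by
    rintro ⟨⟨x, y⟩, hp⟩
    obtain ⟨ψ, hψx, hψy⟩ := (LinearPMap.mem_graph_iff A).1 hp
    simp only at hψx hψy
    subst hψx hψy
    have hv : T' ⟨((ψ : H), A ψ), hp⟩ = shift A w ψ := rfl
    rw [hv]
    have h1 : ‖(ψ : H)‖ ≤ d⁻¹ * ‖shift A w ψ‖ := by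
      rw [inv_mul_eq_div, le_div_iff₀ hd, mul_comm]
      exact hbound ψ
    have h2 : ‖A ψ‖ ≤ ‖shift A w ψ‖ + ‖w‖ * ‖(ψ : H)‖ := by
      have : A ψ = shift A w ψ + w • (ψ : H) := by simp [shift_apply]
      calc ‖A ψ‖ = ‖shift A w ψ + w • (ψ : H)‖ := by rw [← this]
        _ ≤ _ := (norm_add_le _ _).trans (by rw [norm_smul])
    have h3 : ‖w‖ * ‖(ψ : H)‖ ≤ ‖w‖ * (d⁻¹ * ‖shift A w ψ‖) := by gcongr
    have h4 : 0 ≤ d⁻¹ * ‖shift A w ψ‖ := by positivity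
    have h5 : 0 ≤ ‖w‖ * (d⁻¹ * ‖shift A w ψ‖) := by positivity
    have h6 := norm_nonneg (shift A w ψ)
    change max ‖(ψ : H)‖ ‖A ψ‖ ≤ _
    apply max_le <;> linarith
  have hanti : AntilipschitzWith (Real.toNNReal (1 + (‖w‖ + 1) * d⁻¹)) T' :=
    T'.antilipschitz_of_bound fun p => by
      rw [Real.coe_toNNReal _ (by positivity)]
      exact hT' p
  have hrange : (ranShift A w : Set H) = Set.range T' := by
    ext v
    constructor
    · rintro ⟨ψ, rfl⟩
      exact ⟨⟨((ψ : H), A ψ), A.mem_graph ψ⟩, rfl⟩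
    · rintro ⟨⟨⟨x, y⟩, hp⟩, rfl⟩
      obtain ⟨ψ, hψx, hψy⟩ := (LinearPMap.mem_graph_iff A).1 hp
      simp only at hψx hψy
      subst hψx hψy
      exact ⟨ψ, rfl⟩
  rw [hrange]
  exact hanti.isClosed_range T'.uniformContinuous

/-- A bounded extension `S` of `(A - wI)⁻¹` to all of `H` transports `ran (A - wI)` to every other
range: if `u = (A - wI) ψ` then `(A - zI) ψ = u - (z - w) S u`. -/
theorem exists_ranShift_eq_map [CompleteSpace H] {A : H →ₗ.[ℂ] H} (hcl : A.IsClosed)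
    (hreg : IsRegularOp A) (w : ℂ) :
    ∃ S : H →L[ℂ] H, ∀ z : ℂ,
      ranShift A z = (ranShift A w).map ((1 - (z - w) • S : H →L[ℂ] H) : H →ₗ[ℂ] H) := by
  obtain ⟨d, hd, hbound⟩ := hreg w
  have hinj : Function.Injective (shift A w) := by
    rw [← LinearMap.ker_eq_bot, LinearMap.ker_eq_bot']
    intro ψ hψ
    have h := hbound ψ
    rw [hψ, norm_zero] at h
    have h0 : ‖(ψ : H)‖ ≤ 0 := nonpos_of_mul_nonpos_right h hd
    exact Subtype.ext (norm_le_zero_iff.1 h0)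
  have : CompleteSpace (ranShift A w) :=
    (isClosed_ranShift hcl hreg w).completeSpace_coe
  let e : A.domain ≃ₗ[ℂ] ranShift A w := LinearEquiv.ofInjective (shift A w) hinj
  have he : ∀ ψ, (e ψ : H) = shift A w ψ := fun ψ => rfl
  let S₀ : ranShift A w →L[ℂ] H :=
    LinearMap.mkContinuous (A.domain.subtype ∘ₗ e.symm.toLinearMap) d⁻¹ fun u => by
      obtain ⟨ψ, rfl⟩ := e.surjective u
      rw [inv_mul_eq_div, le_div_iff₀ hd, mul_comm]
      simpa [he] using hbound ψ
  refine ⟨S₀.comp (ranShift A w).orthogonalProjectionOnto, fun z => ?_⟩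
  have hS : ∀ ψ : A.domain,
      S₀ ((ranShift A w).orthogonalProjectionOnto (shift A w ψ)) = (ψ : H) := by
    intro ψ
    rw [← he, Submodule.orthogonalProjectionOnto_mem_subspace_eq_self]
    simp [S₀]
  have key : ∀ ψ : A.domain,
      (1 - (z - w) • S₀.comp (ranShift A w).orthogonalProjectionOnto : H →L[ℂ] H) (shift A w ψ) =
        shift A z ψ := by
    intro ψ
    rw [shift_eq_sub A z w]
    simp [hS]
  ext v
  simp only [Submodule.mem_map]
  constructor
  · rintro ⟨ψ, rfl⟩
    exact ⟨shift A w ψ, ⟨ψ, rfl⟩, key ψ⟩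
  · rintro ⟨_, ⟨ψ, rfl⟩, rfl⟩
    exact ⟨ψ, (key ψ).symm⟩

theorem eventually_isUnit_one_sub_smul [CompleteSpace H] (S : H →L[ℂ] H) (w : ℂ) :
    ∀ᶠ z in 𝓝 w, IsUnit (1 - (z - w) • S) := by
  have hc : ContinuousAt (fun z : ℂ => 1 - (z - w) • S) w := by fun_prop
  have h1 : IsUnit (1 - (w - w) • S) := by simp
  exact hc.eventually (Units.isOpen.mem_nhds h1)

/-- An invertible bounded operator preserves hyperplanes, so being a hyperplane is a locally constant
property of `ran (A - zI)`. -/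
theorem eventually_isCoatom_ranShift_iff [CompleteSpace H] {A : H →ₗ.[ℂ] H} (hcl : A.IsClosed)
    (hreg : IsRegularOp A) (w : ℂ) :
    ∀ᶠ z in 𝓝 w, (IsCoatom (ranShift A z) ↔ IsCoatom (ranShift A w)) := by
  obtain ⟨S, hS⟩ := exists_ranShift_eq_map hcl hreg w
  filter_upwards [eventually_isUnit_one_sub_smul S w] with z hz
  obtain ⟨U, hU⟩ := hz
  let e : H ≃L[ℂ] H := ContinuousLinearEquiv.unitsEquiv ℂ H U
  have he : ranShift A z = Submodule.orderIsoMapComap e.toLinearEquiv (ranShift A w) := by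
    rw [hS z, ← hU]
    rfl
  rw [he]
  exact OrderIso.isCoatom_iff _ _

theorem mem_kerAdjoint_iff (A : H →ₗ.[ℂ] H) (z : ℂ) (x : H) :
    x ∈ kerAdjoint A z ↔ x ∈ (ranShift A (starRingEnd ℂ z))ᗮ := by
  rw [Submodule.mem_orthogonal']
  constructor
  · rintro h _ ⟨φ, rfl⟩
    have h' : ⟪x, A φ⟫_ℂ = ⟪z • x, (φ : H)⟫_ℂ := h φ
    rw [shift_apply, inner_sub_right, h', inner_smul_left, inner_smul_right, sub_self]
  · intro h φ
    have h' := h _ ⟨φ, rfl⟩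
    rw [shift_apply, inner_sub_right, inner_smul_right, sub_eq_zero] at h'
    change ⟪x, A φ⟫_ℂ = ⟪z • x, (φ : H)⟫_ℂ
    rw [h', inner_smul_left]

/-- Every `ran (A - zI)` is a hyperplane. At `z = -i` this is the value of a deficiency index, and
`ℂ` is connected. -/
theorem isCoatom_ranShift [CompleteSpace H] {A : H →ₗ.[ℂ] H} (hA : A ∈ classS H) (z : ℂ) :
    IsCoatom (ranShift A z) := by
  obtain ⟨hcl, -, ⟨hdef, -⟩, hreg⟩ := hA
  have hloc := eventually_isCoatom_ranShift_iff hcl hreg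
  have hclopen : IsClopen {z | IsCoatom (ranShift A z)} := by
    constructor
    · rw [← isOpen_compl_iff, isOpen_iff_eventually]
      intro w hw
      filter_upwards [hloc w] with z hz using fun h => hw (hz.1 h)
    · rw [isOpen_iff_eventually]
      intro w hw
      filter_upwards [hloc w] with z hz using hz.2 hw
  have hmem : -Complex.I ∈ {z | IsCoatom (ranShift A z)} := by
    have hker : kerAdjoint A Complex.I = (ranShift A (-Complex.I))ᗮ := by
      ext x
      rw [mem_kerAdjoint_iff, Complex.conj_I]
    have : CompleteSpace (ranShift A (-Complex.I)) :=
      (isClosed_ranShift hcl hreg _).completeSpace_coe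
    rw [hker, rank_submodule_eq_one_iff] at hdef
    obtain ⟨v, hv, hv0, hle⟩ := hdef
    have hspan : (ranShift A (-Complex.I))ᗮ = Submodule.span ℂ {v} :=
      le_antisymm hle ((Submodule.span_singleton_le_iff_mem _ _).2 hv)
    refine (Submodule.isCompl_orthogonal
      (K := ranShift A (-Complex.I))).isCoatom_iff_isAtom.2 ?_
    rw [hspan]
    exact nonzero_span_atom v hv0
  exact Set.eq_univ_iff_forall.1 (hclopen.eq_univ ⟨_, hmem⟩) z

/-- Near `w` the hyperplanes `ran (A - zI)` are kernels of functionals depending analytically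
on `z`, namely of `⟪e, (1 - (z - w) S)⁻¹ ·⟫` with `e` a normal vector of `ran (A - wI)`. -/
theorem exists_analyticAt_functional [CompleteSpace H] {A : H →ₗ.[ℂ] H} (hA : A ∈ classS H)
    (w : ℂ) :
    ∃ F : ℂ → H →L[ℂ] ℂ, AnalyticAt ℂ F w ∧
      ∀ᶠ z in 𝓝 w, ∀ v, v ∈ ranShift A z ↔ F z v = 0 := by
  have hco := isCoatom_ranShift hA w
  obtain ⟨hcl, -, -, hreg⟩ := hA
  have : CompleteSpace (ranShift A w) :=
    (isClosed_ranShift hcl hreg w).completeSpace_coe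
  obtain ⟨S, hS⟩ := exists_ranShift_eq_map hcl hreg w
  obtain ⟨e, he, he0⟩ : ∃ e ∈ (ranShift A w)ᗮ, e ≠ 0 := by
    rw [← Submodule.ne_bot_iff]
    exact fun h => hco.1 (Submodule.orthogonal_eq_bot_iff.1 h)
  let l : H →L[ℂ] ℂ := innerSL ℂ e
  have hl : ∀ v, v ∈ ranShift A w ↔ l v = 0 := by
    have hle : ranShift A w ≤ LinearMap.ker (l : H →ₗ[ℂ] ℂ) := fun v hv =>
      (Submodule.mem_orthogonal' _ _).1 he v hv
    have hne : LinearMap.ker (l : H →ₗ[ℂ] ℂ) ≠ ⊤ := by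
      intro h
      have : e ∈ LinearMap.ker (l : H →ₗ[ℂ] ℂ) := h ▸ Submodule.mem_top
      exact he0 (inner_self_eq_zero.1 this)
    have heq := (hco.le_iff.1 hle).resolve_left hne
    intro v
    rw [← heq]
    rfl
  refine ⟨fun z => l.comp (Ring.inverse (1 - (z - w) • S)), ?_, ?_⟩
  · have h1 : AnalyticAt ℂ (fun z : ℂ => 1 - (z - w) • S) w := by fun_prop
    have h2 : AnalyticAt ℂ Ring.inverse (1 - (w - w) • S) := by
      simpa using analyticAt_inverse (𝕜 := ℂ) (1 : (H →L[ℂ] H)ˣ)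
    exact ((ContinuousLinearMap.compL ℂ H H ℂ l).analyticAt _).comp
      (AnalyticAt.comp (g := Ring.inverse) h2 h1)
  · filter_upwards [eventually_isUnit_one_sub_smul S w] with z hz v
    rw [hS z, ContinuousLinearMap.comp_apply, ← hl]
    obtain ⟨U, hU⟩ := hz
    rw [← hU, Ring.inverse_unit]
    have hUinv : ∀ x, (U : H →L[ℂ] H) ((↑U⁻¹ : H →L[ℂ] H) x) = x := fun x =>
      DFunLike.congr_fun U.mul_inv x
    have hinvU : ∀ x, (↑U⁻¹ : H →L[ℂ] H) ((U : H →L[ℂ] H) x) = x := fun x =>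
      DFunLike.congr_fun U.inv_mul x
    constructor
    · rintro ⟨u, hu, rfl⟩
      change (↑U⁻¹ : H →L[ℂ] H) ((U : H →L[ℂ] H) u) ∈ _
      rwa [hinvU]
    · intro h
      exact ⟨_, h, hUinv v⟩

/-! ### Division of vector polynomials -/

/-- The value at `z` of the polynomial `η₀ + z η₁ + ⋯ + zⁿ ηₙ` with coefficients in `H`. -/
def vecPoly {n : ℕ} (η : Fin (n + 1) → H) (z : ℂ) : H :=
  ∑ j : Fin (n + 1), z ^ (j : ℕ) • η j

theorem vecPoly_succ {n : ℕ} (η : Fin (n + 2) → H) (z : ℂ) :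
    vecPoly η z = η 0 + z • vecPoly (Fin.tail η) z := by
  simp only [vecPoly]
  rw [Fin.sum_univ_succ, Finset.smul_sum]
  simp [Fin.tail, smul_smul, pow_succ']

theorem analyticAt_vecPoly {n : ℕ} (η : Fin (n + 1) → H) (w : ℂ) :
    AnalyticAt ℂ (vecPoly η) w := by
  unfold vecPoly
  fun_prop

/-- The coefficient count is kept at `n + 1`, although the quotient has degree at most `n - 1`, so
that a constant can be added to it also when `n = 0`. -/
theorem exists_vecPoly_eq_add_smul {n : ℕ} (η : Fin (n + 1) → H) (w : ℂ) :
    ∃ q : Fin (n + 1) → H, ∀ z, vecPoly η z = vecPoly η w + (z - w) • vecPoly q z := by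
  induction n with
  | zero => exact ⟨0, fun z => by simp [vecPoly]⟩
  | succ n ih =>
    obtain ⟨q, hq⟩ := ih (Fin.tail η)
    refine ⟨Fin.cons (vecPoly (Fin.tail η) w) q, fun z => ?_⟩
    rw [vecPoly_succ η z, vecPoly_succ η w, vecPoly_succ _ z, Fin.cons_zero, Fin.tail_cons, hq z]
    module

/-- Division by `z - w` modulo `ran (A - zI)` at a point where `η(w)` lies in `ran (A - wI)`. -/
theorem exists_vecPoly_div {A : H →ₗ.[ℂ] H} {n : ℕ} (η : Fin (n + 1) → H) {w : ℂ}
    (hw : vecPoly η w ∈ ranShift A w) :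
    ∃ μ : Fin (n + 1) → H, ∀ z, vecPoly η z - (z - w) • vecPoly μ z ∈ ranShift A z := by
  obtain ⟨ψ, hψ⟩ := hw
  obtain ⟨q, hq⟩ := exists_vecPoly_eq_add_smul η w
  refine ⟨q + Pi.single 0 (ψ : H), fun z => ⟨ψ, ?_⟩⟩
  have hadd : vecPoly (q + Pi.single 0 (ψ : H)) z = vecPoly q z + (ψ : H) := by
    simp only [vecPoly, Pi.add_apply, smul_add, Finset.sum_add_distrib]
    congr 1
    rw [Finset.sum_eq_single 0] <;> simp +contextual
  rw [hadd, hq z, ← hψ, shift_eq_sub A z w]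
  module

/-! ### Removing exceptional points -/

theorem decomposesAt_iff [CompleteSpace H] {A : H →ₗ.[ℂ] H} (hA : A ∈ classS H) {n : ℕ}
    (μ : Fin (n + 1) → H) (z : ℂ) :
    DecomposesAt A μ z ↔ vecPoly μ z ∉ ranShift A z := by
  have hco := isCoatom_ranShift hA z
  change IsCompl (ranShift A z) (Submodule.span ℂ {vecPoly μ z}) ↔ _
  rw [← Submodule.span_singleton_le_iff_mem]
  constructor
  · intro h hle
    exact hco.1 (by simpa [sup_eq_left.2 hle] using h.sup_eq_top)
  · intro h
    have h0 : vecPoly μ z ≠ 0 := by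
      intro h0
      exact h (by simp [h0])
    exact ⟨((nonzero_span_atom _ h0).not_le_iff_disjoint.1 h).symm,
      hco.not_le_iff_codisjoint.1 h⟩

/-- Repeated division at `w`. The induction is on the order of vanishing at `w` of
`z ↦ F z (η(z))`, where `F z` are analytic functionals with kernels `ran (A - zI)`. -/
theorem exists_vecPoly_notMem_of_analyticOrderAt {A : H →ₗ.[ℂ] H} {w : ℂ} {F : ℂ → H →L[ℂ] ℂ}
    (hF : AnalyticAt ℂ F w) (hker : ∀ᶠ z in 𝓝 w, ∀ v, v ∈ ranShift A z ↔ F z v = 0)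
    {n : ℕ} (k : ℕ) (η : Fin (n + 1) → H)
    (hk : analyticOrderAt (fun z => F z (vecPoly η z)) w = k) :
    ∃ μ : Fin (n + 1) → H, vecPoly μ w ∉ ranShift A w ∧
      ∀ z, z ≠ w → vecPoly η z ∉ ranShift A z → vecPoly μ z ∉ ranShift A z := by
  have han : ∀ μ : Fin (n + 1) → H, AnalyticAt ℂ (fun z => F z (vecPoly μ z)) w := fun μ =>
    ((ContinuousLinearMap.id ℂ (H →L[ℂ] ℂ)).analyticAt_bilinear _).comp
      (hF.prod (analyticAt_vecPoly μ w))
  induction k generalizing η with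
  | zero =>
    refine ⟨η, fun h => ?_, fun z _ hz => hz⟩
    exact (han η).analyticOrderAt_eq_zero.1 (by simpa using hk)
      ((hker.self_of_nhds (vecPoly η w)).1 h)
  | succ k ih =>
    have hw : vecPoly η w ∈ ranShift A w := by
      rw [hker.self_of_nhds]
      by_contra h
      rw [(han η).analyticOrderAt_eq_zero.2 h] at hk
      exact absurd hk.symm (by simp)
    obtain ⟨μ, hμ⟩ := exists_vecPoly_div η hw
    have hfac : (fun z => F z (vecPoly η z)) =ᶠ[𝓝 w]
        ((fun z => z - w) * fun z => F z (vecPoly μ z)) := by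
      filter_upwards [hker] with z hz
      have h := (hz _).1 (hμ z)
      rw [map_sub, map_smul, sub_eq_zero] at h
      simpa using h
    have hord : analyticOrderAt (fun z : ℂ => z - w) w = 1 := by
      have h : AnalyticAt ℂ (fun z : ℂ => z - w) w := by fun_prop
      refine (h.analyticOrderAt_eq_natCast (n := 1)).2 ⟨fun _ => 1, analyticAt_const, by simp, ?_⟩
      simp
    rw [analyticOrderAt_congr hfac, analyticOrderAt_mul (by fun_prop) (han μ), hord] at hk
    have hk' : analyticOrderAt (fun z => F z (vecPoly μ z)) w = k := by
      have h : (1 : ℕ∞) + analyticOrderAt (fun z => F z (vecPoly μ z)) w = 1 + k := by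
        rw [hk]; push_cast; ring
      exact ENat.add_right_injective_of_ne_top (by simp) h
    obtain ⟨ν, hν, hν'⟩ := ih μ hk'
    refine ⟨ν, hν, fun z hz hη => hν' z hz fun hmem => hη ?_⟩
    have h := add_mem (hμ z) ((ranShift A z).smul_mem (z - w) hmem)
    rwa [sub_add_cancel] at h

theorem exists_vecPoly_notMem_at [CompleteSpace H] {A : H →ₗ.[ℂ] H} (hA : A ∈ classS H) {n : ℕ}
    (η : Fin (n + 1) → H) (w : ℂ) (hη : ∀ᶠ z in 𝓝[≠] w, vecPoly η z ∉ ranShift A z) :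
    ∃ μ : Fin (n + 1) → H, vecPoly μ w ∉ ranShift A w ∧
      ∀ z, z ≠ w → vecPoly η z ∉ ranShift A z → vecPoly μ z ∉ ranShift A z := by
  obtain ⟨F, hF, hker⟩ := exists_analyticAt_functional hA w
  have hfin : analyticOrderAt (fun z => F z (vecPoly η z)) w ≠ ⊤ := by
    intro h
    rw [analyticOrderAt_eq_top] at h
    obtain ⟨z, ⟨h1, h2⟩, h3⟩ :=
      (((h.and hker).filter_mono nhdsWithin_le_nhds).and hη).exists
    exact h3 ((h2 _).2 h1)
  obtain ⟨k, hk⟩ := ENat.ne_top_iff_exists.1 hfin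
  exact exists_vecPoly_notMem_of_analyticOrderAt hF hker k η hk.symm

theorem exists_vecPoly_forall_notMem [CompleteSpace H] {A : H →ₗ.[ℂ] H} (hA : A ∈ classS H)
    {n : ℕ} {s : Set ℂ} (hs : s.Finite) (η : Fin (n + 1) → H)
    (hη : ∀ z, z ∉ s → vecPoly η z ∉ ranShift A z) :
    ∃ μ : Fin (n + 1) → H, ∀ z, vecPoly μ z ∉ ranShift A z := by
  induction s, hs using Set.Finite.induction_on generalizing η with
  | empty => exact ⟨η, fun z => hη z (Set.notMem_empty z)⟩
  | @insert w s _ hs ih =>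
    have hev : ∀ᶠ z in 𝓝[≠] w, vecPoly η z ∉ ranShift A z := by
      have h1 : ∀ᶠ z in 𝓝[≠] w, z ∉ s :=
        nhdsNE_le_cofinite w hs.compl_mem_cofinite
      filter_upwards [h1, self_mem_nhdsWithin] with z hz hzw
      exact hη z (by simpa [hz] using hzw)
    obtain ⟨μ, hμ, hμ'⟩ := exists_vecPoly_notMem_at hA η w hev
    refine ih μ fun z hz => ?_
    by_cases hzw : z = w
    · exact hzw ▸ hμ
    · exact hμ' z hzw (hη z (by simp [hzw, hz]))

end NEntire

theorem mainTheorem5 {H : Type*} [NormedAddCommGroup H] [InnerProductSpace ℂ H]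
    [CompleteSpace H] (n : ℕ) (A : H →ₗ.[ℂ] H) (hA : A ∈ NEntire.classS H)
    (η : Fin (n + 1) → H)
    (hη : {z : ℂ | ¬ NEntire.DecomposesAt A η z}.Finite) :
    A ∈ NEntire.nEntireClass H n := by
  obtain ⟨μ, hμ⟩ := NEntire.exists_vecPoly_forall_notMem hA hη η fun z hz =>
    (NEntire.decomposesAt_iff hA η z).1 (not_not.1 hz)
  exact ⟨hA, μ, fun z => (NEntire.decomposesAt_iff hA μ z).2 (hμ z)⟩
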